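/- Theorem (Hölder Modulus of Continuity – Uniformly Elliptic). For a symmetric matrix $M\in\mathbb R^{n\times n}$ and $0<\lambda\le\Lambda<\infty$ let $$\mathcal P^-_{\lambda,\Lambda}(M):=\min_{\lambda I\le A\le\Lambda I}A:M,\qquad \mathcal P^+_{\lambda,\Lambda}(M):=\max_{\lambda I\le A\le\Lambda I}A:M,$$ where $A$ ranges over the real symmetric $n\times n$ matrices with $\lambda I\le A\le\Lambda I$ and $A:M=\sum_{i,j}A_{ij}M_{ij}$. Let $B_r=\{x\in\mathbb R^n:|x|<r\}$ and $\operatorname{osc}_E u:=\sup_{x,y\in E}|u(y)-u(x)|\in[0,\infty]$. Let $n\ge 1$ and $0<\lambda\le\Lambda<\infty$. There exist $\alpha\in(0,1)$ and $C\ge1$, depending only on $n$, $\lambda$ and $\Lambda$, with the following property. If $u\in C^2(B_1)$ and $f\in L^n(B_1)$, $f\ge0$, satisfy $$\mathcal P^-_{\lambda,\Lambda}(D^2u)\le f\quad\text{and}\quad \mathcal P^+_{\lambda,\Lambda}(D^2u)\ge -f\quad\text{almost everywhere in }B_1,$$ then $$\sup_{r\in(0,1)}r^{-\alpha}\operatorname{osc}_{B_r}u\le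 C\left(\operatorname{osc}_{B_1}u+\|f\|_{L^n(B_1)}\right).$$ (If $u$ is unbounded on $B_1$, the right-hand side is $+\infty$.) -/

import Mathlib

open MeasureTheory Metric Set

open scoped ENNReal

noncomputable section

namespace KrylovSafonov

/-- The coefficient matrices `A` with `lam I ≤ A ≤ Lam I`, in the sense of the Loewner order on
real symmetric matrices. -/
def ellipticMatrices (n : ℕ) (lam Lam : ℝ) : Set (Matrix (Fin n) (Fin n) ℝ) :=
  {A | (A - lam • (1 : Matrix (Fin n) (Fin n) ℝ)).PosSemidef ∧
    (Lam • (1 : Matrix (Fin n) (Fin n) ℝ) - A).PosSemidef}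

/-- The Frobenius pairing `A : M` of two real square matrices. -/
def frobenius {n : ℕ} (A M : Matrix (Fin n) (Fin n) ℝ) : ℝ :=
  ∑ i, ∑ j, A i j * M i j

/-- The minimal Pucci operator: the minimum of `A : M` over `lam I ≤ A ≤ Lam I`
(attained when `lam ≤ Lam`, see `pucciMinus_isLeast`). -/
def pucciMinus {n : ℕ} (lam Lam : ℝ) (M : Matrix (Fin n) (Fin n) ℝ) : ℝ :=
  sInf ((fun A => frobenius A M) '' ellipticMatrices n lam Lam)

/-- The maximal Pucci operator: the maximum of `A : M` over `lam I ≤ A ≤ Lam I`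
(attained when `lam ≤ Lam`, see `pucciPlus_isGreatest`). -/
def pucciPlus {n : ℕ} (lam Lam : ℝ) (M : Matrix (Fin n) (Fin n) ℝ) : ℝ :=
  sSup ((fun A => frobenius A M) '' ellipticMatrices n lam Lam)

/-- The Hessian matrix `D²u(x)`. -/
def hessian {n : ℕ} (u : EuclideanSpace ℝ (Fin n) → ℝ) (x : EuclideanSpace ℝ (Fin n)) :
    Matrix (Fin n) (Fin n) ℝ :=
  Matrix.of fun i j =>
    fderiv ℝ (fderiv ℝ u) x (EuclideanSpace.single i 1) (EuclideanSpace.single j 1)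

/-- The oscillation of `u` over `E`, the supremum of `|u y - u x|` over `x, y ∈ E`, with the
value `∞` when `u` is unbounded on `E`. -/
def osc {n : ℕ} (u : EuclideanSpace ℝ (Fin n) → ℝ) (E : Set (EuclideanSpace ℝ (Fin n))) : ℝ≥0∞ :=
  ⨆ x ∈ E, ⨆ y ∈ E, ENNReal.ofReal |u y - u x|

theorem ellipticMatrices_nonempty (n : ℕ) {lam Lam : ℝ} (h : lam ≤ Lam) :
    (ellipticMatrices n lam Lam).Nonempty := by
  refine ⟨lam • 1, ?_, ?_⟩
  · rw [sub_self]; exact Matrix.PosSemidef.zero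
  · rw [← sub_smul]; exact Matrix.PosSemidef.one.smul (sub_nonneg.2 h)

theorem isCompact_ellipticMatrices (n : ℕ) (lam Lam : ℝ) :
    IsCompact (ellipticMatrices n lam Lam) := by
  have hps : IsClosed {M : Matrix (Fin n) (Fin n) ℝ | M.PosSemidef} := by
    simp only [Matrix.posSemidef_iff_dotProduct_mulVec, Matrix.IsHermitian, ofPred_and, ofPred_forall]
    refine (isClosed_eq (by fun_prop) (by fun_prop)).inter (isClosed_iInter fun x => ?_)
    refine isClosed_le continuous_const ?_
    fun_prop
  have hcl : IsClosed (ellipticMatrices n lam Lam) :=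
    (hps.preimage (f := fun A => A - lam • 1) (by fun_prop)).inter
      (hps.preimage (f := fun A => Lam • 1 - A) (by fun_prop))
  have hK : IsCompact (Set.univ.pi fun _ : Fin n => Set.univ.pi fun _ : Fin n =>
      Icc (-(2 * (|lam| + |Lam|))) (2 * (|lam| + |Lam|))) :=
    isCompact_univ_pi fun _ => isCompact_univ_pi fun _ => isCompact_Icc
  refine hK.of_isClosed_subset hcl fun (A : Matrix (Fin n) (Fin n) ℝ) hA => ?_
  obtain ⟨h1, h2⟩ := hA
  suffices H : ∀ i j, -(2 * (|lam| + |Lam|)) ≤ A i j ∧ A i j ≤ 2 * (|lam| + |Lam|) from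
    fun i _ j _ => H i j
  intro i j
  have hsym : A j i = A i j := by
    have := congrFun (congrFun (Matrix.posSemidef_iff_dotProduct_mulVec.1 h2).1 i) j
    simp only [Matrix.conjTranspose_apply, Matrix.sub_apply, Matrix.smul_apply, star_trivial] at this
    rw [← Matrix.transpose_apply (1 : Matrix (Fin n) (Fin n) ℝ), Matrix.transpose_one] at this
    linarith
  have d1 := h1.diag_nonneg (i := i)
  have d2 := h2.diag_nonneg (i := i)
  have e1 := h1.diag_nonneg (i := j)
  have e2 := h2.diag_nonneg (i := j)
  simp only [Matrix.sub_apply, Matrix.smul_apply, Matrix.one_apply_eq, smul_eq_mul, mul_one] at d1 d2 e1 e2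
  have a1 := neg_abs_le lam
  have a2 := le_abs_self Lam
  have a3 := abs_nonneg lam
  have a4 := abs_nonneg Lam
  by_cases hij : i = j
  · subst hij
    constructor <;> linarith
  have q1 := (Matrix.posSemidef_iff_dotProduct_mulVec.1 h1).2 (Pi.single i 1 + Pi.single j 1)
  have q2 := (Matrix.posSemidef_iff_dotProduct_mulVec.1 h1).2 (Pi.single i 1 - Pi.single j 1)
  simp [Matrix.mulVec_add, Matrix.mulVec_sub, add_dotProduct, sub_dotProduct, hij, Ne.symm hij, hsym] at q1 q2
  constructor <;> linarith

theorem continuous_frobenius {n : ℕ} (M : Matrix (Fin n) (Fin n) ℝ) :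
    Continuous fun A => frobenius A M := by
  unfold frobenius
  fun_prop

theorem pucciMinus_isLeast {n : ℕ} {lam Lam : ℝ} (h : lam ≤ Lam) (M : Matrix (Fin n) (Fin n) ℝ) :
    IsLeast ((fun A => frobenius A M) '' ellipticMatrices n lam Lam) (pucciMinus lam Lam M) :=
  ((isCompact_ellipticMatrices n lam Lam).image (continuous_frobenius M)).isLeast_sInf
    ((ellipticMatrices_nonempty n h).image _)

theorem pucciPlus_isGreatest {n : ℕ} {lam Lam : ℝ} (h : lam ≤ Lam) (M : Matrix (Fin n) (Fin n) ℝ) :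
    IsGreatest ((fun A => frobenius A M) '' ellipticMatrices n lam Lam) (pucciPlus lam Lam M) :=
  ((isCompact_ellipticMatrices n lam Lam).image (continuous_frobenius M)).isGreatest_sSup
    ((ellipticMatrices_nonempty n h).image _)

end KrylovSafonov

end

namespace KrylovSafonov

open Filter

open scoped Topology

/-! The core is a point-to-measure estimate (`exists_measure_estimate`): if `u ≥ 0` has small energy
(the `Lⁿ` size of the positive part of `P⁻(D²u)`) and `u ≤ m` at one point of the closed `10s`-ball
about `y`, then `u ≤ Km` on a fixed fraction of `B_s(y)`. To see this, add to `u` a Gaussian barrier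
`φ` with `A : D²φ ≤ 0` off `B_s(y)` for every admissible `A`, and touch `u + φ` from below by
planes. All slopes of size less than a multiple of `m/s` occur, so the area formula bounds `(m/s)ⁿ`
by the integral of `det D²(u + φ) ≤ (tr D²(u + φ))ⁿ` over points where this Hessian is nonnegative
and `u + φ ≤ 0`. Ellipticity bounds the trace by the energy density plus a barrier term supported in
`B_s(y)`, where `u + φ ≤ 0` forces `u ≤ Km`.

A Vitali covering by balls placed between the superlevel set and its complement turns this into
geometric decay of `|{u > Kʲm} ∩ B_ρ|` (`exists_superlevel_decay`, `exists_superlevel_small`). If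
`u` came close to both of its bounds `a < b` in `B_ρ`, the decay for `u - a` and `b - u` would give
two sets of less than half measure covering `B_ρ`. So the oscillation drops by a fixed factor
(`exists_oscillation_decay`), and iterating over the radii `8⁻ᵏ` gives the modulus. -/

/-! ### Linear algebra of the Frobenius pairing and the Pucci operators. -/

theorem frobenius_sub_left {n : ℕ} (A B M : Matrix (Fin n) (Fin n) ℝ) :
    frobenius (A - B) M = frobenius A M - frobenius B M := by
  simp only [frobenius, Matrix.sub_apply, sub_mul, Finset.sum_sub_distrib]

theorem frobenius_add_right {n : ℕ} (A M N : Matrix (Fin n) (Fin n) ℝ) :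
    frobenius A (M + N) = frobenius A M + frobenius A N := by
  simp only [frobenius, Matrix.add_apply, mul_add, Finset.sum_add_distrib]

theorem frobenius_sub_right {n : ℕ} (A M N : Matrix (Fin n) (Fin n) ℝ) :
    frobenius A (M - N) = frobenius A M - frobenius A N := by
  simp only [frobenius, Matrix.sub_apply, mul_sub, Finset.sum_sub_distrib]

theorem frobenius_smul_right {n : ℕ} (c : ℝ) (A M : Matrix (Fin n) (Fin n) ℝ) :
    frobenius A (c • M) = c * frobenius A M := by
  simp only [frobenius, Matrix.smul_apply, smul_eq_mul, Finset.mul_sum]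
  exact Finset.sum_congr rfl fun i _ => Finset.sum_congr rfl fun j _ => by ring

theorem frobenius_neg_right {n : ℕ} (A M : Matrix (Fin n) (Fin n) ℝ) :
    frobenius A (-M) = -frobenius A M := by
  simp only [frobenius, Matrix.neg_apply, mul_neg, Finset.sum_neg_distrib]

theorem frobenius_one_right {n : ℕ} (A : Matrix (Fin n) (Fin n) ℝ) :
    frobenius A 1 = A.trace := by
  simp [frobenius, Matrix.trace, Matrix.one_apply]

theorem frobenius_smul_one_left {n : ℕ} (c : ℝ) (M : Matrix (Fin n) (Fin n) ℝ) :
    frobenius (c • 1) M = c * M.trace := by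
  simp [frobenius, Matrix.trace, Matrix.one_apply, Finset.mul_sum]

theorem frobenius_vecMulVec {n : ℕ} (A : Matrix (Fin n) (Fin n) ℝ) (x : Fin n → ℝ) :
    frobenius A (Matrix.vecMulVec x x) = x ⬝ᵥ (A.mulVec x) := by
  simp only [frobenius, Matrix.vecMulVec_apply, dotProduct, Matrix.mulVec, Finset.mul_sum]
  exact Finset.sum_congr rfl fun i _ => Finset.sum_congr rfl fun j _ => by ring

-- Factoring `H = BᵀB` makes the pairing the sum of the quadratic form of `A` over the rows of `B`.
open scoped MatrixOrder in
theorem frobenius_nonneg {n : ℕ} {A H : Matrix (Fin n) (Fin n) ℝ} (hA : A.PosSemidef)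
    (hH : H.PosSemidef) : 0 ≤ frobenius A H := by
  classical
  obtain ⟨B, rfl⟩ := CStarAlgebra.nonneg_iff_eq_star_mul_self.mp hH.nonneg
  rw [Matrix.star_eq_conjTranspose]
  have : frobenius A (B.conjTranspose * B) = ∑ k, B k ⬝ᵥ (A.mulVec (B k)) := by
    simp only [← frobenius_vecMulVec, frobenius, Matrix.mul_apply, Matrix.conjTranspose_apply,
      star_trivial, Finset.mul_sum, Matrix.vecMulVec_apply]
    rw [Finset.sum_congr rfl fun i _ => Finset.sum_comm, Finset.sum_comm]
  rw [this]
  exact Finset.sum_nonneg fun k _ => (Matrix.posSemidef_iff_dotProduct_mulVec.1 hA).2 (B k)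

theorem mul_trace_le_frobenius {n : ℕ} {lam Lam : ℝ} {A H : Matrix (Fin n) (Fin n) ℝ}
    (hA : A ∈ ellipticMatrices n lam Lam) (hH : H.PosSemidef) :
    lam * H.trace ≤ frobenius A H := by
  have := frobenius_nonneg hA.1 hH
  rw [frobenius_sub_left, frobenius_smul_one_left] at this
  linarith

theorem frobenius_le_mul_trace {n : ℕ} {lam Lam : ℝ} {A H : Matrix (Fin n) (Fin n) ℝ}
    (hA : A ∈ ellipticMatrices n lam Lam) (hH : H.PosSemidef) :
    frobenius A H ≤ Lam * H.trace := by
  have := frobenius_nonneg hA.2 hH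
  rw [frobenius_sub_left, frobenius_smul_one_left] at this
  linarith

theorem trace_le {n : ℕ} {lam Lam : ℝ} {A : Matrix (Fin n) (Fin n) ℝ}
    (hA : A ∈ ellipticMatrices n lam Lam) : A.trace ≤ n * Lam := by
  have := frobenius_le_mul_trace hA Matrix.PosSemidef.one
  rw [frobenius_one_right, Matrix.trace_one, Fintype.card_fin] at this
  linarith

theorem mul_dotProduct_self_le {n : ℕ} {lam Lam : ℝ} {A : Matrix (Fin n) (Fin n) ℝ}
    (hA : A ∈ ellipticMatrices n lam Lam) (x : Fin n → ℝ) :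
    lam * (x ⬝ᵥ x) ≤ frobenius A (Matrix.vecMulVec x x) := by
  have h : (Matrix.vecMulVec x x).PosSemidef := by
    simpa using Matrix.posSemidef_vecMulVec_self_star x
  have := mul_trace_le_frobenius hA h
  rwa [Matrix.trace_vecMulVec] at this

/-- Each eigenvalue is at most the sum of all; the sharp arithmetic-geometric constant is not
needed. -/
theorem det_le_trace_pow {n : ℕ} {H : Matrix (Fin n) (Fin n) ℝ} (hH : H.PosSemidef) :
    H.det ≤ H.trace ^ n := by
  rw [hH.1.det_eq_prod_eigenvalues, hH.1.trace_eq_sum_eigenvalues]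
  simp only [RCLike.ofReal_real_eq_id, id]
  calc ∏ i, hH.1.eigenvalues i ≤ ∏ _i : Fin n, ∑ j, hH.1.eigenvalues j :=
        Finset.prod_le_prod (fun i _ => hH.eigenvalues_nonneg i) fun i _ =>
          Finset.single_le_sum (fun j _ => hH.eigenvalues_nonneg j) (Finset.mem_univ i)
    _ = _ := by simp

theorem pucciPlus_eq_neg_pucciMinus_neg {n : ℕ} (lam Lam : ℝ) (M : Matrix (Fin n) (Fin n) ℝ) :
    pucciPlus lam Lam M = -pucciMinus lam Lam (-M) := by
  unfold pucciPlus pucciMinus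
  rw [Real.sInf_def, neg_neg]
  congr 1
  ext t
  simp [frobenius_neg_right, neg_eq_iff_eq_neg]

/-- Take `A` minimising the pairing with `M`. With `M = D²u` and `N` the Hessian of the barrier,
this is the only way ellipticity enters at contact points. -/
theorem exists_mul_trace_add_le {n : ℕ} {lam Lam : ℝ} (h : lam ≤ Lam)
    {M N : Matrix (Fin n) (Fin n) ℝ} (hMN : (M + N).PosSemidef) :
    ∃ A ∈ ellipticMatrices n lam Lam,
      lam * (M + N).trace ≤ pucciMinus lam Lam M + frobenius A N := by
  obtain ⟨A, hA, hAM⟩ := (pucciMinus_isLeast h M).1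
  refine ⟨A, hA, ?_⟩
  rw [← hAM]
  simpa [frobenius_add_right] using mul_trace_le_frobenius hA hMN

/-! ### Hessians, minima and the Gaussian. -/

theorem contDiffAt_fderiv {n : ℕ} {w : EuclideanSpace ℝ (Fin n) → ℝ} {x : EuclideanSpace ℝ (Fin n)}
    (hw : ContDiffAt ℝ 2 w x) : ContDiffAt ℝ 1 (fderiv ℝ w) x :=
  hw.fderiv_right (by norm_num)

theorem hasFDerivAt_fderiv {n : ℕ} {w : EuclideanSpace ℝ (Fin n) → ℝ}
    {x : EuclideanSpace ℝ (Fin n)} (hw : ContDiffAt ℝ 2 w x) :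
    HasFDerivAt (fderiv ℝ w) (fderiv ℝ (fderiv ℝ w) x) x :=
  ((contDiffAt_fderiv hw).differentiableAt one_ne_zero).hasFDerivAt

theorem dotProduct_hessian_mulVec {n : ℕ} (u : EuclideanSpace ℝ (Fin n) → ℝ)
    (x : EuclideanSpace ℝ (Fin n)) (v : Fin n → ℝ) :
    v ⬝ᵥ (hessian u x).mulVec v =
      fderiv ℝ (fderiv ℝ u) x (WithLp.toLp 2 v) (WithLp.toLp 2 v) := by
  have hv : WithLp.toLp 2 v = ∑ i, v i • EuclideanSpace.single i (1 : ℝ) := by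
    ext j
    simp [Finset.sum_apply, Pi.single_apply]
  rw [hv]
  simp only [dotProduct, Matrix.mulVec, hessian, Matrix.of_apply, map_sum, map_smul,
    sum_apply, smul_apply, smul_eq_mul, Finset.mul_sum]
  rw [Finset.sum_comm]
  refine Finset.sum_congr rfl fun i _ => Finset.sum_congr rfl fun j _ => by ring

theorem isHermitian_hessian {n : ℕ} {w : EuclideanSpace ℝ (Fin n) → ℝ}
    {x : EuclideanSpace ℝ (Fin n)} (hw : ContDiffAt ℝ 2 w x) : (hessian w x).IsHermitian := by
  ext i j
  simpa [hessian] using hw.isSymmSndFDerivAt (by simp) (EuclideanSpace.single j 1)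
    (EuclideanSpace.single i 1)

/-- Along a line, a negative second derivative at the minimum would make it a local maximum too; the
restriction would be locally constant, with zero second derivative. -/
theorem fderiv_fderiv_nonneg_of_isLocalMin {n : ℕ} {g : EuclideanSpace ℝ (Fin n) → ℝ}
    {x : EuclideanSpace ℝ (Fin n)} (hg : ContDiffAt ℝ 2 g x) (hmin : IsLocalMin g x)
    (v : EuclideanSpace ℝ (Fin n)) : 0 ≤ fderiv ℝ (fderiv ℝ g) x v v := by
  by_contra! hneg
  set L : ℝ → EuclideanSpace ℝ (Fin n) := fun t => x + t • v with hL
  have hL0 : L 0 = x := by simp [hL]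
  have hLd : ∀ t, HasDerivAt L v t := fun t => by
    simpa [hL] using ((hasDerivAt_id t).smul_const v).const_add x
  have hLc : Tendsto L (𝓝 0) (𝓝 x) := by
    simpa [hL0] using (hLd 0).continuousAt.tendsto
  set h : ℝ → ℝ := fun t => g (L t) with hh
  have hev : ∀ᶠ t in 𝓝 (0 : ℝ), HasDerivAt h (fderiv ℝ g (L t) v) t := by
    have h1 : ∀ᶠ z in 𝓝 x, DifferentiableAt ℝ g z := by
      filter_upwards [hg.eventually (by simp)] with z hz
      exact hz.differentiableAt two_ne_zero
    filter_upwards [hLc.eventually h1] with t ht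
    exact ht.hasFDerivAt.comp_hasDerivAt t (hLd t)
  have hd : deriv h =ᶠ[𝓝 0] fun t => fderiv ℝ g (L t) v := hev.mono fun t ht => ht.deriv
  have hdd : deriv (deriv h) 0 = fderiv ℝ (fderiv ℝ g) x v v := by
    rw [hd.deriv_eq]
    have h2 : HasFDerivAt (fderiv ℝ g) (fderiv ℝ (fderiv ℝ g) x) (L 0) := by
      rw [hL0]; exact hasFDerivAt_fderiv hg
    have h3 := h2.comp_hasDerivAt (0 : ℝ) (hLd 0)
    exact (h3.clm_apply (hasDerivAt_const (0 : ℝ) v)).deriv.trans (by simp)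
  have hhmin : IsLocalMin h 0 := by
    have : ∀ᶠ t in 𝓝 (0 : ℝ), g x ≤ g (L t) := hLc.eventually hmin
    filter_upwards [this] with t ht
    simpa [hh, hL0] using ht
  have hhmax : IsLocalMax h 0 :=
    isLocalMax_of_deriv_deriv_neg (by rwa [hdd]) hhmin.deriv_eq_zero
      hev.self_of_nhds.continuousAt
  have hconst : h =ᶠ[𝓝 0] fun _ => h 0 := by
    filter_upwards [hhmin, hhmax] with t h1 h2 using le_antisymm h2 h1
  have h0 : deriv (deriv h) 0 = 0 := by
    rw [hconst.deriv.deriv_eq]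
    simp
  rw [hdd] at h0
  exact hneg.ne h0

theorem contact_of_isLocalMin {n : ℕ} {w : EuclideanSpace ℝ (Fin n) → ℝ}
    {x : EuclideanSpace ℝ (Fin n)} (hw : ContDiffAt ℝ 2 w x)
    (l : EuclideanSpace ℝ (Fin n) →L[ℝ] ℝ) (hmin : IsLocalMin (fun z => w z - l z) x) :
    fderiv ℝ w x = l ∧ ∀ v, 0 ≤ fderiv ℝ (fderiv ℝ w) x v v := by
  have hev : fderiv ℝ (fun z => w z - l z) =ᶠ[𝓝 x] fun z => fderiv ℝ w z - l := by
    filter_upwards [hw.eventually (by simp)] with z hz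
    exact ((hz.differentiableAt two_ne_zero).hasFDerivAt.sub l.hasFDerivAt).fderiv
  have hC : ContDiffAt ℝ 2 (fun z => w z - l z) x := hw.sub l.contDiff.contDiffAt
  constructor
  · have := hmin.fderiv_eq_zero
    rw [hev.self_of_nhds] at this
    exact sub_eq_zero.1 this
  · intro v
    have := fderiv_fderiv_nonneg_of_isLocalMin hC hmin v
    rwa [hev.fderiv_eq, fderiv_sub_const] at this

theorem posSemidef_hessian {n : ℕ} {w : EuclideanSpace ℝ (Fin n) → ℝ}
    {x : EuclideanSpace ℝ (Fin n)} (hw : ContDiffAt ℝ 2 w x)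
    (hnn : ∀ v, 0 ≤ fderiv ℝ (fderiv ℝ w) x v v) : (hessian w x).PosSemidef := by
  refine Matrix.posSemidef_iff_dotProduct_mulVec.2 ⟨isHermitian_hessian hw, fun v => ?_⟩
  rw [star_trivial, dotProduct_hessian_mulVec]
  exact hnn _

/-- The vector of coordinates of a linear functional. -/
noncomputable def dualCoords (n : ℕ) :
    (EuclideanSpace ℝ (Fin n) →L[ℝ] ℝ) →L[ℝ] EuclideanSpace ℝ (Fin n) :=
  ((EuclideanSpace.equiv (Fin n) ℝ).symm : (Fin n → ℝ) →L[ℝ] EuclideanSpace ℝ (Fin n)).comp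
    (ContinuousLinearMap.pi fun i =>
      ContinuousLinearMap.apply ℝ ℝ (EuclideanSpace.single i (1 : ℝ)))

theorem dualCoords_apply {n : ℕ} (l : EuclideanSpace ℝ (Fin n) →L[ℝ] ℝ) (i : Fin n) :
    dualCoords n l i = l (EuclideanSpace.single i 1) := rfl

theorem dualCoords_innerSL {n : ℕ} (p : EuclideanSpace ℝ (Fin n)) :
    dualCoords n (innerSL ℝ p) = p := by
  ext i
  simp [dualCoords_apply, EuclideanSpace.inner_single_right]

/-- In the standard basis the composite has the transposed Hessian as its matrix, so symmetry of
`D²w` is not needed. -/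
theorem det_dualCoords_comp {n : ℕ} (w : EuclideanSpace ℝ (Fin n) → ℝ)
    (x : EuclideanSpace ℝ (Fin n)) :
    ((dualCoords n).comp (fderiv ℝ (fderiv ℝ w) x)).det = (hessian w x).det := by
  rw [← Matrix.det_transpose, ContinuousLinearMap.det,
    ← LinearMap.det_toMatrix (EuclideanSpace.basisFun (Fin n) ℝ).toBasis]
  congr 1

theorem hessian_add {n : ℕ} {u v : EuclideanSpace ℝ (Fin n) → ℝ} {x : EuclideanSpace ℝ (Fin n)}
    (hu : ContDiffAt ℝ 2 u x) (hv : ContDiffAt ℝ 2 v x) :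
    hessian (fun z => u z + v z) x = hessian u x + hessian v x := by
  have hev : fderiv ℝ (fun z => u z + v z) =ᶠ[𝓝 x] fun z => fderiv ℝ u z + fderiv ℝ v z := by
    filter_upwards [hu.eventually (by simp), hv.eventually (by simp)] with z h1 h2
    exact ((h1.differentiableAt two_ne_zero).hasFDerivAt.add
      (h2.differentiableAt two_ne_zero).hasFDerivAt).fderiv
  have := ((hasFDerivAt_fderiv hu).add (hasFDerivAt_fderiv hv)).fderiv
  ext i j
  simp only [hessian, Matrix.of_apply, Matrix.add_apply, hev.fderiv_eq]
  erw [this]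
  rfl

theorem hessian_const_sub {n : ℕ} (c : ℝ) (u : EuclideanSpace ℝ (Fin n) → ℝ)
    (x : EuclideanSpace ℝ (Fin n)) : hessian (fun z => c - u z) x = -hessian u x := by
  have h : fderiv ℝ (fun z => c - u z) = fun z => -fderiv ℝ u z := by
    ext1 z; exact fderiv_const_sub c
  ext i j
  simp [hessian, h, fderiv_fun_neg]

theorem hessian_sub_const {n : ℕ} (c : ℝ) (u : EuclideanSpace ℝ (Fin n) → ℝ)
    (x : EuclideanSpace ℝ (Fin n)) : hessian (fun z => u z - c) x = hessian u x := by
  have h : fderiv ℝ (fun z => u z - c) = fderiv ℝ u := by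
    ext1 z; exact fderiv_sub_const c
  simp only [hessian, h]

theorem hessian_gaussian {n : ℕ} (a b k : ℝ) (y x : EuclideanSpace ℝ (Fin n)) :
    hessian (fun z => b - k * Real.exp (-(a * ‖z - y‖ ^ 2))) x =
      (k * Real.exp (-(a * ‖x - y‖ ^ 2))) •
        ((2 * a) • 1 - (4 * a ^ 2) • Matrix.vecMulVec (x - y).ofLp (x - y).ofLp) := by
  have hsq : ∀ z, HasFDerivAt (fun z : EuclideanSpace ℝ (Fin n) => ‖z - y‖ ^ 2)
      (2 • innerSL ℝ (z - y)) z := fun z => by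
    simpa using ((hasFDerivAt_id z).sub_const y).norm_sq
  have hE : ∀ z, HasFDerivAt (fun z : EuclideanSpace ℝ (Fin n) => Real.exp (-(a * ‖z - y‖ ^ 2)))
      ((-(2 * a) * Real.exp (-(a * ‖z - y‖ ^ 2))) • innerSL ℝ (z - y)) z := fun z => by
    have h := ((hsq z).const_mul a).neg.exp
    refine h.congr_fderiv ?_
    ext v
    simp
    ring
  have hB : fderiv ℝ (fun z => b - k * Real.exp (-(a * ‖z - y‖ ^ 2))) =
      fun z => (2 * a * k * Real.exp (-(a * ‖z - y‖ ^ 2))) • innerSL ℝ (z - y) := by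
    ext1 z
    rw [(((hE z).const_mul k).const_sub b).fderiv]
    ext v
    simp
    ring
  have hI : HasFDerivAt (fun z : EuclideanSpace ℝ (Fin n) => innerSL ℝ (z - y)) (innerSL ℝ) x :=
    (innerSL ℝ : EuclideanSpace ℝ (Fin n) →L[ℝ] _).hasFDerivAt.comp x
      ((hasFDerivAt_id x).sub_const y)
  have hD := (((hE x).const_mul (2 * a * k)).smul hI).fderiv
  ext i j
  simp only [hessian, Matrix.of_apply, hB]
  erw [hD]
  have hij : innerSL ℝ (EuclideanSpace.single i (1 : ℝ)) (EuclideanSpace.single j (1 : ℝ)) =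
      if i = j then (1 : ℝ) else 0 := by
    rw [innerSL_apply_apply, EuclideanSpace.inner_single_left]
    simp
  simp [Matrix.vecMulVec_apply, Matrix.one_apply, EuclideanSpace.inner_single_right]
  erw [hij]
  split_ifs <;> ring

/-! ### Contact points and the area formula. -/

/-- The points of the closed ball at which `w` is nonpositive and has nonnegative second
derivative. -/
def convexSublevel {n : ℕ} (w : EuclideanSpace ℝ (Fin n) → ℝ) (y : EuclideanSpace ℝ (Fin n))
    (r : ℝ) : Set (EuclideanSpace ℝ (Fin n)) :=
  closedBall y r ∩ {x | w x ≤ 0 ∧ ∀ v, 0 ≤ fderiv ℝ (fderiv ℝ w) x v v}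

/-- Supplies the measurability for the area formula; it follows from continuity of `w` and `D²w`. -/
theorem isClosed_convexSublevel {n : ℕ} {w : EuclideanSpace ℝ (Fin n) → ℝ}
    {y : EuclideanSpace ℝ (Fin n)} {r : ℝ} (hw : ∀ x ∈ closedBall y r, ContDiffAt ℝ 2 w x) :
    IsClosed (convexSublevel w y r) := by
  have h1 : IsClosed (closedBall y r ∩ w ⁻¹' Iic 0) :=
    ContinuousOn.preimage_isClosed_of_isClosed
      (fun x hx => (hw x hx).continuousAt.continuousWithinAt) isClosed_closedBall isClosed_Iic
  have h2 : ∀ v, IsClosed (closedBall y r ∩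
      (fun x => fderiv ℝ (fderiv ℝ w) x v v) ⁻¹' Ici 0) := fun v => by
    refine ContinuousOn.preimage_isClosed_of_isClosed (fun x hx => ?_) isClosed_closedBall
      isClosed_Ici
    have h3 : ContinuousAt (fderiv ℝ (fderiv ℝ w)) x :=
      ((contDiffAt_fderiv (hw x hx)).fderiv_right (m := 0) (by norm_num)).continuousAt
    exact ((h3.clm_apply continuousAt_const).clm_apply continuousAt_const).continuousWithinAt
  convert h1.inter (isClosed_iInter h2) using 1
  ext x
  simp only [convexSublevel, mem_inter_iff, mem_ofPred_eq, mem_iInter, mem_preimage, mem_Iic, mem_Ici]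
  exact ⟨fun h => ⟨⟨h.1, h.2.1⟩, fun v => ⟨h.1, h.2.2 v⟩⟩,
    fun h => ⟨h.1.1, h.1.2, fun v => (h.2 v).2⟩⟩

/-- For `|p| < d` the function `w - p·x` has its minimum in the interior: a boundary minimiser would
need `p·(x - z) ≥ m`, whereas `|x - z| ≤ 2r`. There `∇w = p` and `D²w ≥ 0`, so the gradient maps the
set onto a superset of the ball of slopes. -/
theorem volume_ball_le_lintegral_det {n : ℕ} {w : EuclideanSpace ℝ (Fin n) → ℝ}
    {y z : EuclideanSpace ℝ (Fin n)} {r d m : ℝ} (hr : 0 < r)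
    (hw : ∀ x ∈ closedBall y r, ContDiffAt ℝ 2 w x) (hz : z ∈ closedBall y r) (hwz : w z ≤ -m)
    (hb : ∀ x ∈ sphere y r, 0 ≤ w x) (hd : 2 * r * d ≤ m) :
    volume (ball (0 : EuclideanSpace ℝ (Fin n)) d) ≤
      ∫⁻ x in convexSublevel w y r, ENNReal.ofReal (hessian w x).det := by
  have hsub : ball (0 : EuclideanSpace ℝ (Fin n)) d ⊆
      (fun x => dualCoords n (fderiv ℝ w x)) '' convexSublevel w y r := by
    intro p hp
    have hpd : ‖p‖ < d := by simpa using hp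
    have hinner : ∀ x ∈ closedBall y r, inner ℝ p x - inner ℝ p z < m := by
      intro x hx
      rw [← inner_sub_right]
      have h1 : ‖x - z‖ ≤ 2 * r := by
        rw [← dist_eq_norm]
        calc dist x z ≤ dist x y + dist z y := dist_triangle_right _ _ _
          _ ≤ 2 * r := by linarith [mem_closedBall.1 hx, mem_closedBall.1 hz]
      calc inner ℝ p (x - z) ≤ ‖p‖ * ‖x - z‖ := real_inner_le_norm _ _
        _ ≤ ‖p‖ * (2 * r) := by gcongr
        _ < d * (2 * r) := by gcongr
        _ ≤ m := by linarith
    obtain ⟨x, hx, hmin⟩ := (isCompact_closedBall y r).exists_isMinOn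
      (f := fun x => w x - innerSL ℝ p x) ⟨z, hz⟩
      (fun x hx => ((hw x hx).continuousAt.sub
        (innerSL ℝ p).continuous.continuousAt).continuousWithinAt)
    have hxz : w x - inner ℝ p x ≤ w z - inner ℝ p z := by simpa using hmin hz
    have hxb : x ∈ ball y r := by
      rcases (mem_closedBall.1 hx).lt_or_eq with h | h
      · exact h
      · linarith [hb x h, hinner x hx]
    have hloc : IsLocalMin (fun x => w x - innerSL ℝ p x) x :=
      hmin.isLocalMin (mem_of_superset (isOpen_ball.mem_nhds hxb) ball_subset_closedBall)
    obtain ⟨h1, h2⟩ := contact_of_isLocalMin (hw x hx) _ hloc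
    exact ⟨x, ⟨hx, by linarith [hinner x hx], h2⟩, by simp only [h1, dualCoords_innerSL]⟩
  refine (measure_mono hsub).trans ?_
  have hmeas := (isClosed_convexSublevel hw).measurableSet
  refine (addHaar_image_le_lintegral_abs_det_fderiv volume hmeas
    (f' := fun x => (dualCoords n).comp (fderiv ℝ (fderiv ℝ w) x)) fun x hx => ?_).trans ?_
  · exact ((dualCoords n).hasFDerivAt.comp x (hasFDerivAt_fderiv (hw x hx.1))).hasFDerivWithinAt
  · refine setLIntegral_mono' hmeas fun x hx => ?_
    rw [det_dualCoords_comp, abs_of_nonneg (posSemidef_hessian (hw x hx.1) hx.2.2).det_nonneg]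

/-- The radial term `-4a²λ|x - y|²` cancels the trace term `2anΛ` once `a|x - y|² ≥ κ`, that is, off
`B_s(y)`; this is the choice of `κ`. Inside, only the trace term is kept. -/
theorem frobenius_gaussian_le {n : ℕ} {lam Lam κ s k : ℝ} (hκ : 2 * κ * lam = n * Lam)
    (hlam : 0 < lam) (hLam : 0 ≤ Lam) (hs : 0 < s) (hk : 0 ≤ k)
    {A : Matrix (Fin n) (Fin n) ℝ} (hA : A ∈ ellipticMatrices n lam Lam) (b : ℝ)
    (x y : EuclideanSpace ℝ (Fin n)) :
    frobenius A (hessian (fun z => b - k * Real.exp (-(κ / s ^ 2 * ‖z - y‖ ^ 2))) x) ≤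
      (ball y s).indicator (fun _ => k * (2 * κ * n * Lam) / s ^ 2) x := by
  have hκ0 : 0 ≤ κ := by
    have : 0 ≤ 2 * κ * lam := by rw [hκ]; positivity
    nlinarith
  have hn0 : (0 : ℝ) ≤ n * Lam := by positivity
  set a := κ / s ^ 2 with ha
  have ha0 : 0 ≤ a := by positivity
  set E := Real.exp (-(a * ‖x - y‖ ^ 2)) with hE
  have hE0 : 0 ≤ E := (Real.exp_pos _).le
  have hE1 : E ≤ 1 := Real.exp_le_one_iff.2 (by have := mul_nonneg ha0 (sq_nonneg ‖x - y‖); linarith)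
  have hnorm : (x - y).ofLp ⬝ᵥ (x - y).ofLp = ‖x - y‖ ^ 2 := by
    rw [EuclideanSpace.real_norm_sq_eq]
    simp [dotProduct, sq]
  have htr := trace_le hA
  have hq := mul_dotProduct_self_le hA (x - y).ofLp
  rw [hnorm] at hq
  have hval : frobenius A (hessian (fun z => b - k * Real.exp (-(a * ‖z - y‖ ^ 2))) x) ≤
      k * E * (2 * a * (n * Lam) - 4 * a ^ 2 * (lam * ‖x - y‖ ^ 2)) := by
    rw [hessian_gaussian, frobenius_smul_right, frobenius_sub_right,
      frobenius_smul_right, frobenius_smul_right, frobenius_one_right]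
    gcongr k * E * ?_
    have h1 := mul_le_mul_of_nonneg_left htr (by positivity : 0 ≤ 2 * a)
    have h2 := mul_le_mul_of_nonneg_left hq (by positivity : 0 ≤ 4 * a ^ 2)
    linarith
  refine hval.trans ?_
  by_cases hx : x ∈ ball y s
  · rw [indicator_of_mem hx]
    calc k * E * (2 * a * (n * Lam) - 4 * a ^ 2 * (lam * ‖x - y‖ ^ 2))
        ≤ k * E * (2 * a * (n * Lam)) := by
          gcongr
          have : 0 ≤ 4 * a ^ 2 * (lam * ‖x - y‖ ^ 2) := by positivity
          linarith
      _ ≤ k * 1 * (2 * a * (n * Lam)) := by gcongr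
      _ = _ := by rw [ha]; ring
  · rw [indicator_of_notMem hx]
    have hx' : s ≤ ‖x - y‖ := by
      rw [← dist_eq_norm]; exact not_lt.1 hx
    have h1 : κ ≤ a * ‖x - y‖ ^ 2 := by
      calc κ = a * s ^ 2 := by rw [ha]; field_simp
        _ ≤ _ := by gcongr
    have h2 := mul_le_mul_of_nonneg_left h1 (by positivity : 0 ≤ 4 * a * lam)
    refine mul_nonpos_of_nonneg_of_nonpos (by positivity) ?_
    rw [← hκ]
    linarith

theorem add_pow_le_two_pow_mul (n : ℕ) (a b : ℝ≥0∞) : (a + b) ^ n ≤ 2 ^ n * (a ^ n + b ^ n) := by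
  rcases le_total a b with h | h
  · calc (a + b) ^ n ≤ (b + b) ^ n := by gcongr
      _ = 2 ^ n * b ^ n := by rw [← two_mul, mul_pow]
      _ ≤ _ := by gcongr; exact le_add_self
  · calc (a + b) ^ n ≤ (a + a) ^ n := by gcongr
      _ = 2 ^ n * a ^ n := by rw [← two_mul, mul_pow]
      _ ≤ _ := by gcongr; exact le_self_add

/-! ### The point-to-measure estimate. -/

/-- The `n`-th power of the `Lⁿ` norm of the positive part of the minimal Pucci operator. -/
noncomputable def pucciEnergy {n : ℕ} (lam Lam : ℝ) (u : EuclideanSpace ℝ (Fin n) → ℝ)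
    (S : Set (EuclideanSpace ℝ (Fin n))) : ℝ≥0∞ :=
  ∫⁻ x in S, ENNReal.ofReal (pucciMinus lam Lam (hessian u x)) ^ n

/-- Point-to-measure estimate for nonnegative supersolutions, before the choice of constants. -/
theorem volume_ball_le_pucciEnergy_add {n : ℕ} (hn : 1 ≤ n) {lam Lam κ K s m : ℝ} (hlam : 0 < lam)
    (hLam : lam ≤ Lam) (hκ : 2 * κ * lam = n * Lam) (hK0 : 0 < K)
    (hK : K * (Real.exp (-(100 * κ)) - Real.exp (-(121 * κ))) = 2)
    (hs : 0 < s) (hm : 0 < m) {u : EuclideanSpace ℝ (Fin n) → ℝ}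
    {y z : EuclideanSpace ℝ (Fin n)} (hu : ∀ x ∈ ball y (12 * s), ContDiffAt ℝ 2 u x)
    (hu0 : ∀ x ∈ ball y (12 * s), 0 ≤ u x) (hz : dist z y ≤ 10 * s) (huz : u z ≤ m) :
    volume (ball (0 : EuclideanSpace ℝ (Fin n)) (m / (22 * s))) ≤
      ENNReal.ofReal (2 / lam) ^ n * (pucciEnergy lam Lam u (ball y (12 * s)) +
        ENNReal.ofReal (m * K * (2 * κ * n * Lam) / s ^ 2) ^ n *
          volume (ball y s ∩ {x | u x ≤ K * m})) := by
  have hLam0 : 0 ≤ Lam := hlam.le.trans hLam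
  have hκ0 : 0 ≤ κ := by
    have : 0 ≤ 2 * κ * lam := by rw [hκ]; positivity
    nlinarith
  -- The barrier vanishes on the sphere of radius `11s` and, by `hK`, is at most `-2m` within
  -- distance `10s` of `y`.
  set φ : EuclideanSpace ℝ (Fin n) → ℝ := fun x =>
    m * K * Real.exp (-(121 * κ)) - m * K * Real.exp (-(κ / s ^ 2 * ‖x - y‖ ^ 2)) with hφ
  set w : EuclideanSpace ℝ (Fin n) → ℝ := fun x => u x + φ x with hw
  have hφC : ∀ x, ContDiffAt ℝ 2 φ x := fun x => by
    have : ContDiff ℝ 2 φ :=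
      contDiff_const.sub (contDiff_const.mul (contDiff_const.mul
        ((contDiff_id.sub contDiff_const).norm_sq ℝ)).neg.exp)
    exact this.contDiffAt
  have hsub : closedBall y (11 * s) ⊆ ball y (12 * s) := closedBall_subset_ball (by linarith)
  have hwC : ∀ x ∈ closedBall y (11 * s), ContDiffAt ℝ 2 w x := fun x hx =>
    (hu x (hsub hx)).add (hφC x)
  have hzmem : z ∈ closedBall y (11 * s) := mem_closedBall.2 (by linarith)
  have hwz : w z ≤ -m := by
    have h1 : κ / s ^ 2 * ‖z - y‖ ^ 2 ≤ 100 * κ := by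
      rw [← dist_eq_norm]
      calc κ / s ^ 2 * dist z y ^ 2 ≤ κ / s ^ 2 * (10 * s) ^ 2 := by gcongr
        _ = _ := by field_simp; ring
    have h2 : Real.exp (-(100 * κ)) ≤ Real.exp (-(κ / s ^ 2 * ‖z - y‖ ^ 2)) :=
      Real.exp_le_exp.2 (by linarith)
    have h3 := mul_le_mul_of_nonneg_left h2 (by positivity : 0 ≤ m * K)
    have h4 : m * (K * (Real.exp (-(100 * κ)) - Real.exp (-(121 * κ)))) = m * 2 := by rw [hK]
    simp only [hw, hφ]
    linarith
  have hb : ∀ x ∈ sphere y (11 * s), 0 ≤ w x := by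
    intro x hx
    have h1 : κ / s ^ 2 * ‖x - y‖ ^ 2 = 121 * κ := by
      rw [← dist_eq_norm, mem_sphere.1 hx]
      field_simp; ring
    have := hu0 x (hsub (sphere_subset_closedBall hx))
    simp only [hw, hφ, h1, sub_self, add_zero, this]
  have hmain := volume_ball_le_lintegral_det (d := m / (22 * s)) (by positivity) hwC hzmem hwz hb
    (le_of_eq (by field_simp; ring))
  refine hmain.trans ?_
  set D := ENNReal.ofReal (m * K * (2 * κ * n * Lam) / s ^ 2) with hD
  set S := convexSublevel w y (11 * s) with hS
  have hSm : MeasurableSet S := (isClosed_convexSublevel hwC).measurableSet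
  have hpt : ∀ x ∈ S, ENNReal.ofReal (hessian w x).det ≤ ENNReal.ofReal (2 / lam) ^ n *
      (ENNReal.ofReal (pucciMinus lam Lam (hessian u x)) ^ n +
        (ball y s).indicator (fun _ => D ^ n) x) := by
    intro x hx
    have hpsd := posSemidef_hessian (hwC x hx.1) hx.2.2
    have hadd : hessian w x = hessian u x + hessian φ x := hessian_add (hu x (hsub hx.1)) (hφC x)
    have hdet := det_le_trace_pow hpsd
    rw [hadd] at hpsd hdet ⊢
    obtain ⟨A, hA, htr⟩ := exists_mul_trace_add_le hLam hpsd
    have hfr := frobenius_gaussian_le hκ hlam hLam0 hs (by positivity : 0 ≤ m * K) hA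
      (m * K * Real.exp (-(121 * κ))) x y
    set T := (hessian u x + hessian φ x).trace with hT
    set P := pucciMinus lam Lam (hessian u x) with hP
    have hT2 : ENNReal.ofReal T ≤ ENNReal.ofReal (1 / lam) *
        (ENNReal.ofReal P + (ball y s).indicator (fun _ => D) x) := by
      have h1 : lam * T ≤ P + (ball y s).indicator (fun _ => m * K * (2 * κ * n * Lam) / s ^ 2) x :=
        htr.trans (by linarith)
      have h2 : T ≤ 1 / lam * (P + (ball y s).indicator (fun _ => m * K * (2 * κ * n * Lam) / s ^ 2) x) := by
        rw [one_div, ← div_eq_inv_mul, le_div_iff₀ hlam]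
        linarith
      refine (ENNReal.ofReal_le_ofReal h2).trans ?_
      rw [ENNReal.ofReal_mul (by positivity)]
      gcongr
      refine ENNReal.ofReal_add_le.trans ?_
      gcongr
      by_cases hxs : x ∈ ball y s <;> simp [hxs, hD]
    calc ENNReal.ofReal (hessian u x + hessian φ x).det ≤ ENNReal.ofReal T ^ n := by
          rw [← ENNReal.ofReal_pow hpsd.trace_nonneg]
          exact ENNReal.ofReal_le_ofReal hdet
      _ ≤ (ENNReal.ofReal (1 / lam) *
          (ENNReal.ofReal P + (ball y s).indicator (fun _ => D) x)) ^ n := by gcongr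
      _ ≤ ENNReal.ofReal (1 / lam) ^ n * (2 ^ n *
          (ENNReal.ofReal P ^ n + (ball y s).indicator (fun _ => D) x ^ n)) := by
          rw [mul_pow]
          gcongr
          exact add_pow_le_two_pow_mul _ _ _
      _ = _ := by
          have h2 : ENNReal.ofReal (2 / lam) = ENNReal.ofReal (1 / lam) * 2 := by
            rw [div_eq_mul_one_div, mul_comm, ENNReal.ofReal_mul (by positivity)]
            simp
          rw [h2, mul_pow, mul_assoc]
          congr 3
          by_cases hxs : x ∈ ball y s
          · simp [hxs]
          -- Off the small ball the term is `0 ^ n`, which vanishes because `n ≥ 1`.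
          · simp [hxs, Nat.one_le_iff_ne_zero.1 hn]
  have hss : ball y s ∩ S ⊆ ball y s ∩ {x | u x ≤ K * m} := by
    intro x hx
    refine ⟨hx.1, ?_⟩
    have h1 : u x + φ x ≤ 0 := hx.2.2.1
    have h2 : -(κ / s ^ 2 * ‖x - y‖ ^ 2) ≤ 0 := by
      have : 0 ≤ κ / s ^ 2 * ‖x - y‖ ^ 2 := by positivity
      linarith
    have h3 := mul_le_mul_of_nonneg_left (Real.exp_le_one_iff.2 h2) (by positivity : 0 ≤ m * K)
    have h4 : 0 ≤ m * K * Real.exp (-(121 * κ)) := by positivity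
    simp only [hφ] at h1
    show u x ≤ K * m
    linarith
  refine (setLIntegral_mono' hSm hpt).trans ?_
  rw [lintegral_const_mul' _ _ (by finiteness),
    lintegral_add_right _ (measurable_const.indicator measurableSet_ball),
    lintegral_indicator_const measurableSet_ball, Measure.restrict_apply measurableSet_ball]
  gcongr
  exact lintegral_mono_set (inter_subset_left.trans hsub)

/-- Point-to-measure estimate for nonnegative supersolutions. -/
theorem exists_measure_estimate {n : ℕ} (hn : 1 ≤ n) {lam Lam : ℝ} (hlam : 0 < lam)
    (hLam : lam ≤ Lam) :
    ∃ ε c K : ℝ, 0 < ε ∧ 0 < c ∧ 1 ≤ K ∧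
      ∀ (u : EuclideanSpace ℝ (Fin n) → ℝ) (y z : EuclideanSpace ℝ (Fin n)) (s m : ℝ),
        0 < s → 0 < m → (∀ x ∈ ball y (12 * s), ContDiffAt ℝ 2 u x) →
        (∀ x ∈ ball y (12 * s), 0 ≤ u x) → dist z y ≤ 10 * s → u z ≤ m →
        pucciEnergy lam Lam u (ball y (12 * s)) ≤ ENNReal.ofReal ((ε * m / s) ^ n) →
        c * s ^ n ≤ volume.real (ball y s ∩ {x | u x ≤ K * m}) := by
  have hLam0 : 0 < Lam := hlam.trans_le hLam
  have hn' : (0 : ℝ) < n := by exact_mod_cast hn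
  set κ : ℝ := n * Lam / (2 * lam) with hκd
  have hκ : 2 * κ * lam = n * Lam := by rw [hκd]; field_simp
  have hκ0 : 0 < κ := by positivity
  set e := Real.exp (-(100 * κ)) - Real.exp (-(121 * κ)) with he
  have he0 : 0 < e := sub_pos.2 (Real.exp_lt_exp.2 (by linarith))
  have he1 : e ≤ 1 := by
    have h1 : Real.exp (-(100 * κ)) ≤ 1 := Real.exp_le_one_iff.2 (by linarith)
    linarith [Real.exp_pos (-(121 * κ))]
  set K := 2 / e with hKd
  have hK : K * e = 2 := by rw [hKd]; field_simp
  have hK1 : 1 ≤ K := by rw [hKd, le_div_iff₀ he0]; linarith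
  have hK0 : 0 < K := by linarith
  set C := K * (2 * κ * n * Lam) with hC
  have hC0 : 0 < C := by positivity
  set ω := volume.real (ball (0 : EuclideanSpace ℝ (Fin n)) 1) with hω
  have hω0 : 0 < ω := ENNReal.toReal_pos (measure_ball_pos _ _ one_pos).ne' (by finiteness)
  -- With `ηⁿ ≤ η ≤ ω / 2`, the energy accounts for at most half of the volume of slopes; the rest
  -- must come from the sublevel set.
  set η := min 1 (ω / 2) with hη
  have hη0 : 0 < η := by positivity
  have hηn : η ^ n ≤ ω / 2 :=
    (pow_le_of_le_one hη0.le (min_le_left _ _) (by omega)).trans (min_le_right _ _)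
  refine ⟨lam / 44 * η, ω / 2 * (lam / (44 * C)) ^ n, K, by positivity, by positivity, hK1, ?_⟩
  intro u y z s m hs hm hu hu0 hz huz hen
  have key := volume_ball_le_pucciEnergy_add hn hlam hLam hκ hK0 hK hs hm hu hu0 hz huz
  rw [show m * K * (2 * κ * n * Lam) = m * C by rw [hC]; ring] at key
  set V := volume.real (ball y s ∩ {x | u x ≤ K * m}) with hV
  have hVe : volume (ball y s ∩ {x | u x ≤ K * m}) = ENNReal.ofReal V :=
    (ofReal_measureReal (measure_inter_lt_top_of_left_ne_top (by finiteness)).ne).symm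
  have hball : volume (ball (0 : EuclideanSpace ℝ (Fin n)) (m / (22 * s))) =
      ENNReal.ofReal ((m / (22 * s)) ^ n * ω) := by
    rw [Measure.addHaar_ball_of_pos _ _ (by positivity), finrank_euclideanSpace_fin,
      ENNReal.ofReal_mul (by positivity), hω, ofReal_measureReal (by finiteness)]
  have key2 : ENNReal.ofReal ((m / (22 * s)) ^ n * ω) ≤ ENNReal.ofReal ((2 / lam) ^ n *
      ((lam / 44 * η * m / s) ^ n + (m * C / s ^ 2) ^ n * V)) := by
    rw [← hball]
    refine key.trans ?_
    rw [hVe, ENNReal.ofReal_mul (by positivity), ENNReal.ofReal_add (by positivity) (by positivity),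
      ENNReal.ofReal_mul (by positivity), ENNReal.ofReal_pow (by positivity),
      ENNReal.ofReal_pow (p := m * C / s ^ 2) (by positivity)]
    gcongr
  rw [ENNReal.ofReal_le_ofReal_iff (by positivity)] at key2
  have h1 : (m / (22 * s)) ^ n * ω = (m / s) ^ n * ((1 / 22) ^ n * ω) := by
    rw [← mul_assoc, ← mul_pow]; congr 2; field_simp
  have h2 : (2 / lam) ^ n * ((lam / 44 * η * m / s) ^ n + (m * C / s ^ 2) ^ n * V) =
      (m / s) ^ n * ((1 / 22) ^ n * (η ^ n + (44 * C / lam / s) ^ n * V)) := by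
    have e1 : 2 / lam * (lam / 44 * η * m / s) = m / s * (1 / 22 * η) := by field_simp; norm_num
    have e2 : 2 / lam * (m * C / s ^ 2) = m / s * (1 / 22 * (44 * C / lam / s)) := by
      field_simp; norm_num
    rw [mul_add, ← mul_assoc, ← mul_pow, ← mul_pow, e1, e2]
    simp only [mul_pow]
    ring
  rw [h1, h2] at key2
  have key3 := le_of_mul_le_mul_left (le_of_mul_le_mul_left key2 (by positivity)) (by positivity)
  have h3 : ω / 2 ≤ (44 * C / lam / s) ^ n * V := by linarith
  calc ω / 2 * (lam / (44 * C)) ^ n * s ^ n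
      ≤ (44 * C / lam / s) ^ n * V * (lam / (44 * C)) ^ n * s ^ n := by gcongr
    _ = (44 * C / lam / s * (lam / (44 * C)) * s) ^ n * V := by rw [mul_pow, mul_pow]; ring
    _ = V := by
        rw [show 44 * C / lam / s * (lam / (44 * C)) * s = 1 by field_simp]; simp

/-! ### Covering and decay of superlevel sets. -/

theorem isOpen_ball_inter_superlevel {n : ℕ} {u : EuclideanSpace ℝ (Fin n) → ℝ}
    {y : EuclideanSpace ℝ (Fin n)} {r : ℝ} (hu : ∀ x ∈ ball y r, ContDiffAt ℝ 2 u x) (m : ℝ) :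
    IsOpen (ball y r ∩ {x | m < u x}) :=
  ContinuousOn.isOpen_inter_preimage
    (fun x hx => (hu x hx).continuousAt.continuousWithinAt) isOpen_ball isOpen_Ioi

/-- Around every point of the superlevel set there is a ball that lies well inside it and whose
tenfold dilation meets the sublevel set. -/
theorem exists_inner_ball {n : ℕ} {S : Set (EuclideanSpace ℝ (Fin n))} {ρ : ℝ}
    {z x : EuclideanSpace ℝ (Fin n)} (hS : IsOpen (ball 0 ρ ∩ S)) (hzρ : z ∈ ball 0 ρ)
    (hz : z ∉ S) (hx : x ∈ ball 0 ρ ∩ S) :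
    ∃ (y : EuclideanSpace ℝ (Fin n)) (s : ℝ), 0 < s ∧ s ≤ ρ / 2 ∧ ball y s ⊆ ball 0 ρ ∩ S ∧
      ball y s ⊆ closedBall x (2 * s) ∧ ball y (12 * s) ⊆ ball 0 (8 * ρ) ∧
      ∃ z' ∈ ball 0 ρ \ S, dist z' y ≤ 10 * s := by
  set T : Set (EuclideanSpace ℝ (Fin n)) := ball 0 ρ \ S with hT
  have hTne : T.Nonempty := ⟨z, hzρ, hz⟩
  set r := infDist x T with hr
  have hxρ : ‖x‖ < ρ := by simpa using hx.1
  have hzρ' : ‖z‖ < ρ := by simpa using hzρ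
  have hρ : 0 < ρ := (norm_nonneg x).trans_lt hxρ
  have hr0 : 0 < r := by
    obtain ⟨d, hd, hsub⟩ := Metric.isOpen_iff.1 hS x hx
    refine hd.trans_le ((le_infDist hTne).2 fun t ht => ?_)
    by_contra! hlt
    exact ht.2 (hsub (mem_ball'.2 hlt)).2
  have hr2 : r ≤ 2 * ρ := by
    refine (infDist_le_dist_of_mem (show z ∈ T from ⟨hzρ, hz⟩)).trans ?_
    rw [dist_eq_norm]
    linarith [norm_sub_le x z]
  obtain ⟨z', hz'T, hz'd⟩ := (infDist_lt_iff hTne).1 (show infDist x T < 2 * r by linarith)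
  have hq0 : 0 ≤ r / (4 * ρ) := by positivity
  have hq1 : r / (4 * ρ) ≤ 1 := by rw [div_le_one (by positivity)]; linarith
  have hqx : r / (4 * ρ) * ρ = r / 4 := by field_simp
  -- Moving `x` towards the origin by at most `r / 4` leaves room in `B_ρ` for the ball of radius `s
  -- = r / 4`, and `z'` is within `2r + r / 4 = 9s` of `y`.
  set y := (1 - r / (4 * ρ)) • x with hy
  have hyn : ‖y‖ ≤ ρ - r / 4 := by
    rw [hy, norm_smul, Real.norm_of_nonneg (by linarith)]
    calc (1 - r / (4 * ρ)) * ‖x‖ ≤ (1 - r / (4 * ρ)) * ρ := by gcongr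
      _ = ρ - r / 4 := by rw [sub_mul, hqx, one_mul]
  have hyx : dist y x ≤ r / 4 := by
    rw [dist_eq_norm, hy, sub_smul, one_smul, sub_sub_cancel_left, norm_neg, norm_smul,
      Real.norm_of_nonneg hq0]
    calc r / (4 * ρ) * ‖x‖ ≤ r / (4 * ρ) * ρ := by gcongr
      _ = r / 4 := hqx
  refine ⟨y, r / 4, by linarith, by linarith, ?_, ?_, ?_, z', hz'T, ?_⟩
  · intro t ht
    have htρ : t ∈ ball (0 : EuclideanSpace ℝ (Fin n)) ρ := by
      rw [mem_ball_zero_iff]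
      have := norm_le_norm_add_norm_sub' t y
      rw [← dist_eq_norm] at this
      linarith [mem_ball.1 ht]
    refine ⟨htρ, ?_⟩
    by_contra hts
    have h1 : r ≤ dist x t := infDist_le_dist_of_mem ⟨htρ, hts⟩
    have h2 := dist_triangle_left x t y
    linarith [mem_ball'.1 ht]
  · intro t ht
    have := dist_triangle t y x
    exact mem_closedBall.2 (by linarith [mem_ball.1 ht])
  · intro t ht
    rw [mem_ball_zero_iff]
    have := norm_le_norm_add_norm_sub' t y
    rw [← dist_eq_norm] at this
    linarith [mem_ball.1 ht]
  · have := dist_triangle_left z' y x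
    rw [dist_comm x y] at this
    linarith

/-- A covering argument: if each point of a bounded set `F` has a nearby ball in which `G`
occupies a fixed proportion, then so does `G` in `F`. -/
theorem volume_le_of_forall_ball {n : ℕ} {F G : Set (EuclideanSpace ℝ (Fin n))} {c R : ℝ}
    (hc : 0 < c) (hG : MeasurableSet G)
    (h : ∀ x ∈ F, ∃ (y : EuclideanSpace ℝ (Fin n)) (s : ℝ), 0 < s ∧ s ≤ R ∧
      ball y s ⊆ closedBall x (2 * s) ∧ c * s ^ n ≤ volume.real (ball y s ∩ G)) :
    volume F ≤ ENNReal.ofReal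
      (11 ^ n * volume.real (ball (0 : EuclideanSpace ℝ (Fin n)) 1) / c) * volume G := by
  choose! y s hs hsR hsub hvol using h
  -- The balls of radius `2s` contain the inner balls, so disjointness passes to these. Enlarging by
  -- `5` gives radius `10s`; `11s` makes the cover open.
  obtain ⟨t, htF, htd, htc⟩ := Vitali.exists_disjoint_subfamily_covering_enlargement_closedBall
    F (fun x => x) (fun x => 2 * s x) (2 * R) (fun x hx => by linarith [hsR x hx]) 5 (by norm_num)
  have htcount : t.Countable := htd.countable_of_nonempty_interior fun x hx =>
    ⟨x, ball_subset_interior_closedBall (mem_ball_self (by linarith [hs x (htF hx)]))⟩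
  have hcov : F ⊆ ⋃ x ∈ t, ball x (11 * s x) := by
    intro x hx
    obtain ⟨b, hb, hxb⟩ := htc x hx
    have h0 := hs x hx
    have h1 := hs b (htF hb)
    refine mem_iUnion₂.2 ⟨b, hb, closedBall_subset_ball (by linarith)
      (hxb (mem_closedBall_self (by linarith)))⟩
  set ω := volume.real (ball (0 : EuclideanSpace ℝ (Fin n)) 1) with hω
  have hω0 : 0 ≤ ω := measureReal_nonneg
  calc volume F ≤ volume (⋃ x ∈ t, ball x (11 * s x)) := measure_mono hcov
    _ ≤ ∑' x : t, volume (ball (x : EuclideanSpace ℝ (Fin n)) (11 * s x)) :=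
        measure_biUnion_le _ htcount _
    _ ≤ ∑' x : t, ENNReal.ofReal (11 ^ n * ω / c) * volume (ball (y x) (s x) ∩ G) := by
        refine ENNReal.tsum_le_tsum fun x => ?_
        have hx := htF x.2
        have hsx := hs _ hx
        have h1 : volume (ball (y x) (s x) ∩ G) =
            ENNReal.ofReal (volume.real (ball (y x) (s x) ∩ G)) :=
          (ofReal_measureReal (measure_inter_lt_top_of_left_ne_top (by finiteness)).ne).symm
        rw [h1, ← ENNReal.ofReal_mul (by positivity),
          Measure.addHaar_ball_of_pos _ _ (by linarith), finrank_euclideanSpace_fin,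
          ← ofReal_measureReal (μ := volume) (s := ball (0 : EuclideanSpace ℝ (Fin n)) 1)
            (by finiteness), ← ENNReal.ofReal_mul (by positivity)]
        refine ENNReal.ofReal_le_ofReal ?_
        calc (11 * s x) ^ n * ω = 11 ^ n * ω / c * (c * s x ^ n) := by rw [mul_pow]; field_simp
          _ ≤ _ := by gcongr; exact hvol _ hx
    _ = ENNReal.ofReal (11 ^ n * ω / c) * ∑' x : t, volume (ball (y x) (s x) ∩ G) :=
        ENNReal.tsum_mul_left
    _ = ENNReal.ofReal (11 ^ n * ω / c) * volume (⋃ x ∈ t, ball (y x) (s x) ∩ G) := by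
        rw [measure_biUnion htcount _ fun x _ => measurableSet_ball.inter hG]
        exact htd.mono_on fun x hx => inter_subset_left.trans (hsub x (htF hx))
    _ ≤ _ := by
        gcongr
        exact iUnion₂_subset fun x _ => inter_subset_right

/-- Geometric decay of the superlevel sets, one step. -/
theorem exists_superlevel_decay {n : ℕ} (hn : 1 ≤ n) {lam Lam : ℝ} (hlam : 0 < lam)
    (hLam : lam ≤ Lam) :
    ∃ ε θ K : ℝ, 0 < ε ∧ 0 ≤ θ ∧ θ < 1 ∧ 1 ≤ K ∧
      ∀ (u : EuclideanSpace ℝ (Fin n) → ℝ) (z : EuclideanSpace ℝ (Fin n)) (ρ m : ℝ),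
        0 < m → (∀ x ∈ ball 0 (8 * ρ), ContDiffAt ℝ 2 u x) →
        (∀ x ∈ ball 0 (8 * ρ), 0 ≤ u x) → z ∈ ball 0 ρ → u z ≤ m →
        pucciEnergy lam Lam u (ball 0 (8 * ρ)) ≤ ENNReal.ofReal ((ε * m / ρ) ^ n) →
        volume.real (ball 0 ρ ∩ {x | K * m < u x}) ≤
          θ * volume.real (ball 0 ρ ∩ {x | m < u x}) := by
  obtain ⟨ε, c, K, hε, hc, hK, hmeas⟩ := exists_measure_estimate hn hlam hLam
  set ω := volume.real (ball (0 : EuclideanSpace ℝ (Fin n)) 1) with hω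
  have hω0 : 0 ≤ ω := measureReal_nonneg
  set B := 11 ^ n * ω / c with hB
  have hB0 : 0 ≤ B := by positivity
  -- Adding `|E| ≤ |F|` to `|F| ≤ B(|F| - |E|)` and dropping `|F|` against `|E|` gives `(B + 1)|E| ≤
  -- B|F|`.
  refine ⟨ε, B / (B + 1), K, hε, by positivity, by rw [div_lt_one] <;> linarith, hK, ?_⟩
  intro u z ρ m hm hu hu0 hzρ huz hen
  have hρ : 0 < ρ := pos_of_mem_ball hzρ
  have hu' : ∀ x ∈ ball 0 ρ, ContDiffAt ℝ 2 u x := fun x hx =>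
    hu x (ball_subset_ball (by linarith) hx)
  have hFo := isOpen_ball_inter_superlevel hu' m
  have hEo := isOpen_ball_inter_superlevel hu' (K * m)
  set F := ball 0 ρ ∩ {x | m < u x} with hF
  set E := ball 0 ρ ∩ {x | K * m < u x} with hE
  have hEF : E ⊆ F := fun x hx => ⟨hx.1, (le_mul_of_one_le_left hm.le hK).trans_lt hx.2⟩
  have hFfin : volume F ≠ ⊤ := (measure_inter_lt_top_of_left_ne_top (by finiteness)).ne
  have hGfin : volume (F \ E) ≠ ⊤ := measure_ne_top_of_subset sdiff_subset hFfin
  have hcov : volume F ≤ ENNReal.ofReal B * volume (F \ E) := by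
    refine volume_le_of_forall_ball (R := ρ / 2) hc
      (hFo.measurableSet.diff hEo.measurableSet) fun x hx => ?_
    obtain ⟨y, s, hs, hsρ, h1, h2, h3, z', hz', hz'y⟩ :=
      exists_inner_ball hFo hzρ (not_lt.2 huz) hx
    refine ⟨y, s, hs, hsρ, h2, ?_⟩
    have hen' : pucciEnergy lam Lam u (ball y (12 * s)) ≤ ENNReal.ofReal ((ε * m / s) ^ n) := by
      refine (lintegral_mono_set h3).trans (hen.trans (ENNReal.ofReal_le_ofReal ?_))
      gcongr
      linarith
    refine (hmeas u y z' s m hs hm (fun x hx => hu x (h3 hx)) (fun x hx => hu0 x (h3 hx)) hz'y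
      (not_lt.1 hz'.2) hen').trans ?_
    refine measureReal_mono (fun t ht => ⟨ht.1, h1 ht.1, fun htE => ?_⟩)
      (measure_inter_lt_top_of_left_ne_top (by finiteness)).ne
    exact absurd (show u t ≤ K * m from ht.2) (not_le.2 htE.2)
  have hreal : volume.real F ≤ B * volume.real (F \ E) := by
    have := ENNReal.toReal_mono (by finiteness) hcov
    rwa [ENNReal.toReal_mul, ENNReal.toReal_ofReal hB0] at this
  rw [measureReal_sdiff hEF hEo.measurableSet hFfin] at hreal
  rw [div_mul_eq_mul_div, le_div_iff₀ (by linarith)]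
  linarith [measureReal_mono (μ := volume) hEF hFfin]

/-- Superlevel sets at a high level have small density. -/
theorem exists_superlevel_small {n : ℕ} (hn : 1 ≤ n) {lam Lam : ℝ} (hlam : 0 < lam)
    (hLam : lam ≤ Lam) :
    ∃ ε L : ℝ, 0 < ε ∧ 1 ≤ L ∧
      ∀ (u : EuclideanSpace ℝ (Fin n) → ℝ) (z : EuclideanSpace ℝ (Fin n)) (ρ m : ℝ),
        0 < m → (∀ x ∈ ball 0 (8 * ρ), ContDiffAt ℝ 2 u x) →
        (∀ x ∈ ball 0 (8 * ρ), 0 ≤ u x) → z ∈ ball 0 ρ → u z ≤ m →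
        pucciEnergy lam Lam u (ball 0 (8 * ρ)) ≤ ENNReal.ofReal ((ε * m / ρ) ^ n) →
        volume.real (ball 0 ρ ∩ {x | L * m < u x}) <
          1 / 2 * volume.real (ball (0 : EuclideanSpace ℝ (Fin n)) ρ) := by
  obtain ⟨ε, θ, K, hε, hθ0, hθ1, hK, hdecay⟩ := exists_superlevel_decay hn hlam hLam
  obtain ⟨k, hk⟩ := exists_pow_lt_of_lt_one (by norm_num : (0 : ℝ) < 1 / 2) hθ1
  refine ⟨ε, K ^ k, hε, one_le_pow₀ hK, fun u z ρ m hm hu hu0 hz huz hen => ?_⟩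
  have hρ : 0 < ρ := pos_of_mem_ball hz
  have hiter : ∀ j : ℕ, volume.real (ball 0 ρ ∩ {x | K ^ j * m < u x}) ≤
      θ ^ j * volume.real (ball (0 : EuclideanSpace ℝ (Fin n)) ρ) := by
    intro j
    induction j with
    | zero =>
      rw [pow_zero θ, one_mul]
      exact measureReal_mono inter_subset_left (by finiteness)
    | succ j ih =>
      have hKj : m ≤ K ^ j * m := le_mul_of_one_le_left hm.le (one_le_pow₀ hK)
      -- Raising the level only weakens the energy condition, and the same point `z` still serves.
      have hen' : pucciEnergy lam Lam u (ball 0 (8 * ρ)) ≤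
          ENNReal.ofReal ((ε * (K ^ j * m) / ρ) ^ n) :=
        hen.trans (ENNReal.ofReal_le_ofReal (by gcongr))
      have h1 := hdecay u z ρ (K ^ j * m) (hm.trans_le hKj) hu hu0 hz (huz.trans hKj) hen'
      rw [pow_succ' K, mul_assoc, pow_succ' θ, mul_assoc]
      exact h1.trans (by gcongr)
  have hvol : 0 < volume.real (ball (0 : EuclideanSpace ℝ (Fin n)) ρ) :=
    ENNReal.toReal_pos (measure_ball_pos _ _ hρ).ne' (by finiteness)
  exact (hiter k).trans_lt (by gcongr)

/-! ### Decay of oscillation. -/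

theorem hessian_neg {n : ℕ} (u : EuclideanSpace ℝ (Fin n) → ℝ) (x : EuclideanSpace ℝ (Fin n)) :
    hessian (fun z => -u z) x = -hessian u x := by
  simpa using hessian_const_sub 0 u x

theorem pucciEnergy_sub_const {n : ℕ} (lam Lam c : ℝ) (u : EuclideanSpace ℝ (Fin n) → ℝ)
    (S : Set (EuclideanSpace ℝ (Fin n))) :
    pucciEnergy lam Lam (fun x => u x - c) S = pucciEnergy lam Lam u S := by
  simp only [pucciEnergy, hessian_sub_const]

theorem pucciEnergy_const_sub {n : ℕ} (lam Lam c : ℝ) (u : EuclideanSpace ℝ (Fin n) → ℝ)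
    (S : Set (EuclideanSpace ℝ (Fin n))) :
    pucciEnergy lam Lam (fun x => c - u x) S = pucciEnergy lam Lam (fun x => -u x) S := by
  simp only [pucciEnergy, hessian_const_sub, hessian_neg]

/-- Oscillation decay from a ball to a concentric smaller ball. -/
theorem exists_oscillation_decay {n : ℕ} (hn : 1 ≤ n) {lam Lam : ℝ} (hlam : 0 < lam)
    (hLam : lam ≤ Lam) :
    ∃ ε γ : ℝ, 0 < ε ∧ 1 / 2 ≤ γ ∧ γ < 1 ∧
      ∀ (u : EuclideanSpace ℝ (Fin n) → ℝ) (ρ a b : ℝ), 0 < ρ → a < b →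
        (∀ x ∈ ball 0 (8 * ρ), ContDiffAt ℝ 2 u x) →
        (∀ x ∈ ball 0 (8 * ρ), a ≤ u x ∧ u x ≤ b) →
        pucciEnergy lam Lam u (ball 0 (8 * ρ)) ≤ ENNReal.ofReal ((ε * (b - a) / ρ) ^ n) →
        pucciEnergy lam Lam (fun x => -u x) (ball 0 (8 * ρ)) ≤
          ENNReal.ofReal ((ε * (b - a) / ρ) ^ n) →
        ∃ a' b' : ℝ, b' - a' = γ * (b - a) ∧ ∀ x ∈ ball 0 ρ, a' ≤ u x ∧ u x ≤ b' := by
  obtain ⟨ε, L, hε, hL, hsmall⟩ := exists_superlevel_small hn hlam hLam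
  have hL0 : 0 < L := by linarith
  have hL3 : 1 / (3 * L) ≤ 1 / 2 := by
    apply one_div_le_one_div_of_le <;> linarith
  have hL3' : 0 < 1 / (3 * L) := by positivity
  refine ⟨ε / (3 * L), 1 - 1 / (3 * L), by positivity, by linarith, by linarith, ?_⟩
  intro u ρ a b hρ hab hu hu0 hen hen'
  -- Now `L * m` is a third of `b - a`, so no point has both `u - a` and `b - u` at most `L * m`.
  set m := (b - a) / (3 * L) with hm
  have hba : 0 < b - a := sub_pos.2 hab
  have hm0 : 0 < m := by positivity
  have hLm : L * m = (b - a) / 3 := by rw [hm]; field_simp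
  have heq : ε / (3 * L) * (b - a) = ε * m := by rw [hm]; ring
  have hlen : (1 - 1 / (3 * L)) * (b - a) = b - a - m := by rw [hm]; ring
  rw [heq] at hen hen'
  rw [hlen]
  by_cases h1 : ∀ x ∈ ball (0 : EuclideanSpace ℝ (Fin n)) ρ, a + m ≤ u x
  · exact ⟨a + m, b, by ring, fun x hx => ⟨h1 x hx, (hu0 x (ball_subset_ball (by linarith) hx)).2⟩⟩
  by_cases h2 : ∀ x ∈ ball (0 : EuclideanSpace ℝ (Fin n)) ρ, u x ≤ b - m
  · exact ⟨a, b - m, by ring, fun x hx => ⟨(hu0 x (ball_subset_ball (by linarith) hx)).1, h2 x hx⟩⟩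
  push Not at h1 h2
  obtain ⟨z₁, hz₁, hz₁m⟩ := h1
  obtain ⟨z₂, hz₂, hz₂m⟩ := h2
  have e1 := hsmall (fun x => u x - a) z₁ ρ m hm0 (fun x hx => (hu x hx).sub contDiffAt_const)
    (fun x hx => by linarith [(hu0 x hx).1]) hz₁ (by linarith)
    (by rwa [pucciEnergy_sub_const])
  have e2 := hsmall (fun x => b - u x) z₂ ρ m hm0 (fun x hx => contDiffAt_const.sub (hu x hx))
    (fun x hx => by linarith [(hu0 x hx).2]) hz₂ (by linarith)
    (by rwa [pucciEnergy_const_sub])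
  have hcov : ball (0 : EuclideanSpace ℝ (Fin n)) ρ ⊆ ball 0 ρ ∩ {x | L * m < u x - a} ∪
      ball 0 ρ ∩ {x | L * m < b - u x} := by
    intro x hx
    rcases lt_or_ge (L * m) (u x - a) with h | h
    · exact Or.inl ⟨hx, h⟩
    · exact Or.inr ⟨hx, show L * m < b - u x by linarith⟩
  have h3 := (measureReal_mono (μ := volume) hcov (measure_union_lt_top
    (measure_inter_lt_top_of_left_ne_top (by finiteness))
    (measure_inter_lt_top_of_left_ne_top (by finiteness))).ne).trans (measureReal_union_le _ _)
  linarith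

theorem abs_sub_le_toReal_osc {n : ℕ} {u : EuclideanSpace ℝ (Fin n) → ℝ}
    {S : Set (EuclideanSpace ℝ (Fin n))} (hS : osc u S ≠ ⊤) {x y : EuclideanSpace ℝ (Fin n)}
    (hx : x ∈ S) (hy : y ∈ S) : |u y - u x| ≤ (osc u S).toReal := by
  have h : ENNReal.ofReal |u y - u x| ≤ osc u S :=
    le_iSup₂_of_le x hx (le_iSup₂_of_le y hy le_rfl)
  exact (ENNReal.ofReal_le_iff_le_toReal hS).1 h

theorem osc_le_of_forall_mem_Icc {n : ℕ} {u : EuclideanSpace ℝ (Fin n) → ℝ}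
    {S : Set (EuclideanSpace ℝ (Fin n))} {a b : ℝ} (h : ∀ x ∈ S, a ≤ u x ∧ u x ≤ b) :
    osc u S ≤ ENNReal.ofReal (b - a) := by
  refine iSup₂_le fun x hx => iSup₂_le fun y hy => ENNReal.ofReal_le_ofReal ?_
  rw [abs_le]
  constructor <;> linarith [(h x hx).1, (h x hx).2, (h y hy).1, (h y hy).2]

theorem osc_mono {n : ℕ} {u : EuclideanSpace ℝ (Fin n) → ℝ}
    {S T : Set (EuclideanSpace ℝ (Fin n))} (h : S ⊆ T) : osc u S ≤ osc u T :=
  iSup₂_le fun x hx => iSup₂_le fun y hy =>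
    le_iSup₂_of_le x (h hx) (le_iSup₂_of_le y (h hy) le_rfl)

theorem pucciEnergy_le_eLpNorm_pow {n : ℕ} (hn : 1 ≤ n) {lam Lam : ℝ}
    {u f : EuclideanSpace ℝ (Fin n) → ℝ} {S T : Set (EuclideanSpace ℝ (Fin n))} (hST : S ⊆ T)
    (h : ∀ᵐ x ∂(volume.restrict T), pucciMinus lam Lam (hessian u x) ≤ f x) :
    pucciEnergy lam Lam u S ≤ eLpNorm f (n : ℝ≥0∞) (volume.restrict T) ^ n := by
  have hn0 : n ≠ 0 := by omega
  rw [eLpNorm_eq_lintegral_rpow_enorm_toReal (by exact_mod_cast hn0) (by finiteness),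
    ENNReal.toReal_natCast, one_div, ← ENNReal.rpow_natCast, ← ENNReal.rpow_mul,
    inv_mul_cancel₀ (by exact_mod_cast hn0), ENNReal.rpow_one]
  refine (lintegral_mono_set hST).trans (lintegral_mono_ae ?_)
  filter_upwards [h] with x hx
  rw [ENNReal.rpow_natCast]
  gcongr
  exact (ENNReal.ofReal_le_ofReal hx).trans (Real.ofReal_le_enorm _)

end KrylovSafonov

/-! ### Iteration over the scales `8⁻ᵏ`. -/

open KrylovSafonov in
theorem mainTheorem1 (n : ℕ) (hn : 1 ≤ n) (lam Lam : ℝ) (hlam : 0 < lam) (hLam : lam ≤ Lam) :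
    ∃ α C : ℝ, 0 < α ∧ α < 1 ∧ 1 ≤ C ∧
      ∀ u f : EuclideanSpace ℝ (Fin n) → ℝ,
        ContDiffOn ℝ 2 u (ball 0 1) →
        MemLp f (n : ℝ≥0∞) (volume.restrict (ball 0 1)) →
        (∀ᵐ x ∂(volume.restrict (ball (0 : EuclideanSpace ℝ (Fin n)) 1)), 0 ≤ f x) →
        (∀ᵐ x ∂(volume.restrict (ball (0 : EuclideanSpace ℝ (Fin n)) 1)),
          KrylovSafonov.pucciMinus lam Lam (KrylovSafonov.hessian u x) ≤ f x) →
        (∀ᵐ x ∂(volume.restrict (ball (0 : EuclideanSpace ℝ (Fin n)) 1)),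
          -f x ≤ KrylovSafonov.pucciPlus lam Lam (KrylovSafonov.hessian u x)) →
        (⨆ r ∈ Ioo (0 : ℝ) 1, ENNReal.ofReal (r ^ (-α)) * KrylovSafonov.osc u (ball 0 r)) ≤
          ENNReal.ofReal C *
            (KrylovSafonov.osc u (ball 0 1) +
              eLpNorm f (n : ℝ≥0∞) (volume.restrict (ball 0 1))) := by
  obtain ⟨ε, γ, hε, hγ, hγ1, hdecay⟩ := exists_oscillation_decay hn hlam hLam
  have hγ0 : 0 < γ := by linarith
  have hlog8 : 0 < Real.log 8 := Real.log_pos (by norm_num)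
  -- Chosen so that `8^(-α) = γ`; `γ ≥ 1/2 > 1/8` gives `α < 1`.
  set α := -Real.log γ / Real.log 8 with hα
  have hα0 : 0 < α := div_pos (neg_pos.2 (Real.log_neg hγ0 hγ1)) hlog8
  have hα1 : α < 1 := by
    rw [hα, div_lt_one hlog8, ← Real.log_inv]
    exact Real.log_lt_log (by positivity) ((inv_anti₀ (by norm_num) hγ).trans_lt (by norm_num))
  have h8α : ((1 / 8 : ℝ)) ^ (-α) = γ⁻¹ := by
    rw [Real.rpow_def_of_pos (by norm_num), one_div, Real.log_inv, hα,
      show -Real.log 8 * -(-Real.log γ / Real.log 8) = -Real.log γ by field_simp,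
      Real.exp_neg, Real.exp_log hγ0]
  -- The `2` lets an interval of length `X` centred at `u 0` contain all values of `u`; the `1 / ε`
  -- gives `N ≤ ε * X`.
  set C₀ := max 2 (1 / ε) with hC₀
  have hC₀2 : 2 ≤ C₀ := le_max_left _ _
  have hC₀ε : 1 ≤ ε * C₀ := by
    have : ε * (1 / ε) ≤ ε * C₀ := by gcongr; exact le_max_right _ _
    rwa [mul_one_div_cancel hε.ne'] at this
  refine ⟨α, C₀ * γ⁻¹, hα0, hα1, ?_, fun u f hu hf _ hminus hplus => ?_⟩
  · exact one_le_mul_of_one_le_of_one_le (by linarith) ((one_le_inv₀ hγ0).2 hγ1.le)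
  by_cases hosc : osc u (ball 0 1) = ⊤
  · rw [hosc, top_add, ENNReal.mul_top (ENNReal.ofReal_pos.2 (by positivity)).ne']
    exact le_top
  refine iSup₂_le fun r hr => ?_
  set W := (osc u (ball 0 1)).toReal with hW
  have hWe : osc u (ball 0 1) = ENNReal.ofReal W := (ENNReal.ofReal_toReal hosc).symm
  -- Constant `u` is set apart because the decay step needs `a < b`, hence `X > 0`.
  rcases (show 0 ≤ W from ENNReal.toReal_nonneg).eq_or_lt with hW0 | hW0
  · have h0 : osc u (ball 0 r) = 0 := by
      refine le_antisymm ((osc_mono (ball_subset_ball hr.2.le)).trans ?_) zero_le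
      rw [hWe, ← hW0, ENNReal.ofReal_zero]
    rw [h0, mul_zero]
    exact zero_le
  set N := (eLpNorm f (n : ℝ≥0∞) (volume.restrict (ball 0 1))).toReal with hN
  have hNe : eLpNorm f (n : ℝ≥0∞) (volume.restrict (ball 0 1)) = ENNReal.ofReal N :=
    (ENNReal.ofReal_toReal hf.eLpNorm_ne_top).symm
  have hN0 : 0 ≤ N := ENNReal.toReal_nonneg
  set X := C₀ * (W + N) with hX
  have hX0 : 0 < X := by positivity
  have hXW : 2 * W ≤ X := by
    rw [hX]; exact mul_le_mul hC₀2 (by linarith) hW0.le (by linarith)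
  have hXN : N ≤ ε * X := by
    rw [hX, ← mul_assoc]
    calc N ≤ 1 * (W + N) := by linarith
      _ ≤ _ := by gcongr
  have hplus' : ∀ᵐ x ∂(volume.restrict (ball (0 : EuclideanSpace ℝ (Fin n)) 1)),
      pucciMinus lam Lam (hessian (fun z => -u z) x) ≤ f x := by
    filter_upwards [hplus] with x hx
    rw [pucciPlus_eq_neg_pucciMinus_neg] at hx
    rw [hessian_neg]
    linarith
  have hiter : ∀ k : ℕ, ∃ a b : ℝ, b - a = γ ^ k * X ∧
      ∀ x ∈ ball (0 : EuclideanSpace ℝ (Fin n)) ((1 / 8) ^ k), a ≤ u x ∧ u x ≤ b := by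
    intro k
    induction k with
    | zero =>
      refine ⟨u 0 - X / 2, u 0 + X / 2, by ring, fun x hx => ?_⟩
      rw [pow_zero] at hx
      have := abs_le.1 (abs_sub_le_toReal_osc hosc (mem_ball_self one_pos) hx)
      constructor <;> linarith [this.1, this.2]
    | succ k ih =>
      obtain ⟨a, b, hab, hubd⟩ := ih
      have hρ0 : (0 : ℝ) < (1 / 8) ^ (k + 1) := by positivity
      have h8 : 8 * (1 / 8 : ℝ) ^ (k + 1) = (1 / 8) ^ k := by rw [pow_succ]; ring
      have hsub : ball (0 : EuclideanSpace ℝ (Fin n)) ((1 / 8) ^ k) ⊆ ball 0 1 :=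
        ball_subset_ball (pow_le_one₀ (by norm_num) (by norm_num))
      have hNn : ENNReal.ofReal N ^ n ≤
          ENNReal.ofReal ((ε * (b - a) / (1 / 8) ^ (k + 1)) ^ n) := by
        rw [← ENNReal.ofReal_pow hN0, hab]
        refine ENNReal.ofReal_le_ofReal (pow_le_pow_left₀ hN0 ?_ n)
        rw [le_div_iff₀ hρ0]
        -- The right-hand side gains `1/8` per scale and the oscillation only `γ ≥ 1/2`, so
        -- smallness of the energy persists.
        have h1 : (1 / 8 : ℝ) ^ (k + 1) ≤ γ ^ k :=
          (pow_le_pow_of_le_one (by norm_num) (by norm_num) k.le_succ).trans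
            (pow_le_pow_left₀ (by norm_num) (by linarith) k)
        calc N * (1 / 8) ^ (k + 1) ≤ ε * X * γ ^ k := by gcongr
          _ = _ := by ring
      have hdec := hdecay u ((1 / 8) ^ (k + 1)) a b hρ0
        (sub_pos.1 (by rw [hab]; positivity))
      rw [h8] at hdec
      obtain ⟨a', b', hab', hubd'⟩ := hdec
        (fun x hx => hu.contDiffAt (isOpen_ball.mem_nhds (hsub hx))) hubd
        ((pucciEnergy_le_eLpNorm_pow hn hsub hminus).trans (hNe ▸ hNn))
        ((pucciEnergy_le_eLpNorm_pow hn hsub hplus').trans (hNe ▸ hNn))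
      exact ⟨a', b', by rw [hab', hab]; ring, hubd'⟩
  -- Here `8^(-(k+1)) < r ≤ 8^(-k)`; the mismatch of one scale costs the factor `γ⁻¹` in the
  -- constant.
  obtain ⟨k, hk1, hk2⟩ := exists_nat_pow_near_of_lt_one hr.1 hr.2.le
    (by norm_num : (0 : ℝ) < 1 / 8) (by norm_num)
  obtain ⟨a, b, hab, hubd⟩ := hiter k
  have hosc_r : osc u (ball 0 r) ≤ ENNReal.ofReal (γ ^ k * X) := by
    rw [← hab]
    exact osc_le_of_forall_mem_Icc fun x hx => hubd x (ball_subset_ball hk2 hx)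
  have hrα : r ^ (-α) ≤ (γ⁻¹) ^ (k + 1) := by
    rw [← h8α, ← Real.rpow_natCast, ← Real.rpow_mul (by norm_num), mul_comm (-α),
      Real.rpow_mul (by norm_num), Real.rpow_natCast]
    exact Real.rpow_le_rpow_of_nonpos (by positivity) hk1.le (by linarith)
  rw [hWe, hNe, ← ENNReal.ofReal_add hW0.le hN0, ← ENNReal.ofReal_mul (by positivity)]
  calc ENNReal.ofReal (r ^ (-α)) * osc u (ball 0 r)
      ≤ ENNReal.ofReal ((γ⁻¹) ^ (k + 1)) * ENNReal.ofReal (γ ^ k * X) := by gcongr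
    _ = ENNReal.ofReal (C₀ * γ⁻¹ * (W + N)) := by
        rw [← ENNReal.ofReal_mul (by positivity), hX]
        congr 1
        rw [pow_succ, inv_pow]
        field_simp
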